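/- Let $k$ be a difference field of characteristic $0$, that is, a field with a ring endomorphism $\sigma$, and let $m\ge 0$. Let $k\{\mathbb Y\}=k\{y_1,\dots,y_m\}$ be the difference polynomial ring, i.e. the polynomial ring over $k$ in the variables $\sigma^i(y_j)$ ($i\ge 0$, $1\le j\le m$) with its natural endomorphism $\sigma$. A difference variety $X\subseteq\mathbb A^m$ over $k$ assigns to every difference field extension $K$ of $k$ the set $X(K)=\{a\in K^m: f(a)=0 \text{ for all } f\in F\}$, for some fixed $F\subseteq k\{\mathbb Y\}$; its vanishing ideal is $\mathbb I(X)=\{f\in k\{\mathbb Y\}: f(a)=0 \text{ for all } K \text{ and all } a\in X(K)\}$. For $p=\sum_i c_ix^i\in\mathbb Z[x]$ and a nonzero $a$ in a difference field put $a^p=\prod_i\sigma^i(a)^{c_i}$, and for $\mathbf u\in\mathbb Z[x]^n$ and $\mathbf t=(t_1,\dots,t_n)$ put $\mathbf t^{\mathbf u}=\prod_i t_i^{u_i}$; define $\mathbb Y^{\mathbf a}\in k\{\mathbb Y\}$ for $\mathbf a\in\mathbb N[x]^m$ in the same way. A difference variety $X\subseteq\mathbb A^m$ is called toric if, for some $n\ge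 0$ and some $\mathbf u_1,\dots,\mathbf u_m\in\mathbb Z[x]^n$, it is the Cohn closure in $\mathbb A^m$ (the smallest difference variety containing the given points) of the points $(\mathbf t^{\mathbf u_1},\dots,\mathbf t^{\mathbf u_m})$, where $\mathbf t\in (K\setminus\{0\})^n$ and $K$ runs over all difference field extensions of $k$. A $\mathbb Z[x]$-submodule $L\subseteq\mathbb Z[x]^m$ is called toric if it is $\mathbb Z[x]$-saturated: $g\mathbf w\in L$ with $0\neq g\in\mathbb Z[x]$ and $\mathbf w\in\mathbb Z[x]^m$ implies $\mathbf w\in L$. An ideal of $k\{\mathbb Y\}$ is called a toric difference ideal if it equals $$\mathcal I_L=[\,\mathbb Y^{\mathbf a}-\mathbb Y^{\mathbf b} : \mathbf a,\mathbf b\in\mathbb N[x]^m,\ \mathbf a-\mathbf b\in L\,]$$ for some toric $L\subseteq\mathbb Z[x]^m$, where $[S]$ denotes the smallest $\sigma$-stable ideal containing $S$. **Theorem.** A difference variety $X\subseteq\mathbb A^m$ over $k$ is toric if and only if $\mathbb I(X)$ is a toric difference ideal. -/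

import Mathlib

open Polynomial

universe u

namespace ToricDifference

/-- A difference ring (`σ`-ring): a commutative ring with a ring endomorphism `σ`.
A difference field is a field carrying this structure. -/
class DifferenceRing (R : Type*) [CommRing R] where
  σ : R →+* R

/-- A difference field extension `K` of the difference field `k`. -/
structure DifferenceExtension (k : Type u) [Field k] [DifferenceRing k] where
  carrier : Type u
  [field : Field carrier]
  [difference : DifferenceRing carrier]
  [algebra : Algebra k carrier]
  σ_algebraMap : ∀ c : k, DifferenceRing.σ (algebraMap k carrier c) =
    algebraMap k carrier (DifferenceRing.σ c)

attribute [instance] DifferenceExtension.field DifferenceExtension.difference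
  DifferenceExtension.algebra

instance (k : Type u) [Field k] [DifferenceRing k] :
    CoeSort (DifferenceExtension k) (Type u) :=
  ⟨DifferenceExtension.carrier⟩

/-- The difference polynomial ring `k{y₁, …, yₘ}`: the polynomial ring in the variables
`σⁱ(yⱼ)`, where `σⁱ(yⱼ)` is the variable with index `(j, i)`. -/
abbrev DiffPoly (k : Type u) [Field k] (m : ℕ) : Type u :=
  MvPolynomial (Fin m × ℕ) k

section Definitions

variable {k : Type u} [Field k] [DifferenceRing k] {m n : ℕ}

/-- The difference operator of `k{y₁, …, yₘ}`: it acts as `σ` on `k` and sends `σⁱ(yⱼ)`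
to `σⁱ⁺¹(yⱼ)`. -/
noncomputable def diffPolyσ : DiffPoly k m →+* DiffPoly k m :=
  MvPolynomial.eval₂Hom (MvPolynomial.C.comp DifferenceRing.σ)
    (fun v => MvPolynomial.X (v.1, v.2 + 1))

/-- The value `f(a)` of a difference polynomial at a point `a ∈ Kᵐ`, as a ring
homomorphism in `f`. -/
noncomputable def evalAt (K : DifferenceExtension k) (a : Fin m → K) : DiffPoly k m →+* K :=
  MvPolynomial.eval₂Hom (algebraMap k K) (fun v => (⇑(DifferenceRing.σ (R := K)))^[v.2] (a v.1))

/-- A subset of the difference affine space `𝔸ᵐ` over `k`: a set of `K`-points for every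
difference field extension `K` of `k`, ordered by inclusion for all `K`. -/
abbrev AffineSubset (k : Type u) [Field k] [DifferenceRing k] (m : ℕ) :=
  (K : DifferenceExtension k) → Set (Fin m → K)

/-- The solutions `𝕍(F)` of a set `F` of difference polynomials. -/
def zeroLocus (F : Set (DiffPoly k m)) : AffineSubset k m :=
  fun K => {a | ∀ f ∈ F, evalAt K a f = 0}

/-- `𝕍(F)` is a functor: a morphism of extensions of `k` maps solutions to solutions. -/
theorem zeroLocus_map (F : Set (DiffPoly k m)) (K K' : DifferenceExtension k)
    (φ : K →ₐ[k] K')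
    (hφ : ∀ c : K, φ (DifferenceRing.σ c) = DifferenceRing.σ (φ c))
    (a : Fin m → K) (ha : a ∈ zeroLocus F K) : (fun j => φ (a j)) ∈ zeroLocus F K' := by
  have key : (φ : K →+* K').comp (evalAt K a) = evalAt K' (fun j => φ (a j)) := by
    apply MvPolynomial.ringHom_ext
    · intro c
      simp [evalAt]
    · intro v
      have h : Function.Semiconj φ (DifferenceRing.σ (R := K)) (DifferenceRing.σ (R := K')) := hφ
      simpa [evalAt] using (h.iterate_right v.2) (a v.1)
  intro f hf
  rw [← key, RingHom.comp_apply, ha f hf, map_zero]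

/-- A difference variety in `𝔸ᵐ` over `k`. -/
def IsDifferenceVariety (X : AffineSubset k m) : Prop :=
  ∃ F : Set (DiffPoly k m), X = zeroLocus F

/-- The vanishing ideal `𝕀(X)`. -/
def vanishingIdeal (X : AffineSubset k m) : Ideal (DiffPoly k m) where
  carrier := {f | ∀ (K : DifferenceExtension k), ∀ a ∈ X K, evalAt K a f = 0}
  zero_mem' := fun K a _ => map_zero _
  add_mem' := fun hf hg K a ha => by rw [map_add, hf K a ha, hg K a ha, add_zero]
  smul_mem' := fun c f hf K a ha => by rw [smul_eq_mul, map_mul, hf K a ha, mul_zero]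

/-- The symbolic power `a ^ p = ∏ᵢ σⁱ(a) ^ cᵢ` for `p = ∑ᵢ cᵢ xⁱ ∈ ℤ[x]`
(used only for `a ≠ 0`). -/
noncomputable def symPow {K : Type u} [Field K] [DifferenceRing K] (a : K) (p : ℤ[X]) : K :=
  ∏ i ∈ p.support, ((⇑(DifferenceRing.σ (R := K)))^[i] a) ^ (p.coeff i)

/-- The value `t ^ w = ∏ᵢ tᵢ ^ wᵢ` of the Laurent difference monomial with support
`w ∈ ℤ[x]ⁿ` at `t ∈ (K*)ⁿ`. -/
noncomputable def laurentMonomial {K : Type u} [Field K] [DifferenceRing K]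
    (t : Fin n → K) (w : Fin n → ℤ[X]) : K :=
  ∏ i, symPow (t i) (w i)

/-- The quasi difference torus of `U = (u₁, …, uₘ)`, `uⱼ ∈ ℤ[x]ⁿ`: for every `K`, the image of
`(K*)ⁿ → Kᵐ`, `t ↦ (t ^ u₁, …, t ^ uₘ)`. -/
def quasiTorus (k : Type u) [Field k] [DifferenceRing k] (U : Fin m → Fin n → ℤ[X]) :
    AffineSubset k m :=
  fun K => {a | ∃ t : Fin n → K, (∀ i, t i ≠ 0) ∧ a = fun j => laurentMonomial t (U j)}

/-- `X` is the Cohn closure of `T` in `𝔸ᵐ`: the smallest difference variety containing `T`. -/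
def IsCohnClosure (T X : AffineSubset k m) : Prop :=
  IsLeast {Y : AffineSubset k m | IsDifferenceVariety Y ∧ T ≤ Y} X

/-- `X ⊆ 𝔸ᵐ` is toric: it is the Cohn closure of a quasi difference torus in `𝔸ᵐ`. -/
def IsToric (X : AffineSubset k m) : Prop :=
  ∃ (n : ℕ) (U : Fin m → Fin n → ℤ[X]), IsCohnClosure (quasiTorus k U) X

/-- A `ℤ[x]`-lattice `L ⊆ ℤ[x]ᵐ` is toric if it is `ℤ[x]`-saturated. -/
def IsToricLattice (L : Submodule ℤ[X] (Fin m → ℤ[X])) : Prop :=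
  ∀ g : ℤ[X], g ≠ 0 → ∀ w : Fin m → ℤ[X], g • w ∈ L → w ∈ L

/-- `I` is a difference ideal of `k{y₁, …, yₘ}`: an ideal stable under `σ`. -/
def IsDifferenceIdeal (I : Ideal (DiffPoly k m)) : Prop :=
  ∀ f ∈ I, diffPolyσ f ∈ I

/-- The difference ideal `[S]` generated by `S`. -/
noncomputable def differenceSpan (S : Set (DiffPoly k m)) : Ideal (DiffPoly k m) :=
  sInf {I | IsDifferenceIdeal I ∧ S ⊆ I}

/-- The difference monomial `Y ^ a = ∏ⱼ ∏ᵢ σⁱ(yⱼ) ^ aⱼᵢ` for `a ∈ ℕ[x]ᵐ`,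
where `aⱼ = ∑ᵢ aⱼᵢ xⁱ`. -/
noncomputable def diffMonomial (k : Type u) [Field k] (a : Fin m → ℕ[X]) : DiffPoly k m :=
  ∏ j, ∏ i ∈ (a j).support, MvPolynomial.X (j, i) ^ ((a j).coeff i)

/-- The inclusion `ℕ[x]ᵐ → ℤ[x]ᵐ`. -/
noncomputable def toIntVec (a : Fin m → ℕ[X]) : Fin m → ℤ[X] :=
  fun j => (a j).map (Nat.castRingHom ℤ)

/-- The binomial difference ideal
`I_L = [Y ^ a - Y ^ b | a, b ∈ ℕ[x]ᵐ, a - b ∈ L]` of a `ℤ[x]`-lattice `L ⊆ ℤ[x]ᵐ`. -/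
noncomputable def latticeIdeal (k : Type u) [Field k] [DifferenceRing k]
    (L : Submodule ℤ[X] (Fin m → ℤ[X])) : Ideal (DiffPoly k m) :=
  differenceSpan {f | ∃ a b : Fin m → ℕ[X], toIntVec a - toIntVec b ∈ L ∧
    f = diffMonomial k a - diffMonomial k b}

/-- A toric difference ideal: the ideal `I_L` of a toric `ℤ[x]`-lattice `L`. -/
def IsToricIdeal (I : Ideal (DiffPoly k m)) : Prop :=
  ∃ L : Submodule ℤ[X] (Fin m → ℤ[X]), IsToricLattice L ∧ I = latticeIdeal k L

end Definitions

end ToricDifference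

/-! Evaluating a difference polynomial at a torus point `t ^ U` factors through the map from `k{Y}`
to the group algebra `k[ℤ[x]ⁿ]` induced on exponents by `U` (`evalAt_laurentMonomial`). This group
algebra is a domain with injective `σ`, so its fraction field is a difference field containing a
generic torus point, and the vanishing ideal of the torus is exactly the kernel of that map
(`mem_vanishingIdeal_quasiTorus`). Such a kernel is spanned by differences of monomials with equal
image, hence equals `I_L` for `L = ker U` (`vanishingIdeal_quasiTorus`).

It remains to see that the kernels of matrices over `ℤ[x]` are precisely the saturated lattices
(`isToricLattice_ker`, `exists_ker_linearCombination_eq`), and that the Cohn closure is the zero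
locus of the vanishing ideal (`isCohnClosure_iff`). -/

namespace ToricDifference

/-! ### Saturated lattices as kernels of matrices -/

section Saturated

/-- A saturated submodule of a finite free module over a domain is the kernel of a linear map
into a finite free module. -/
theorem exists_ker_linearCombination_eq {R : Type*} [CommRing R] [IsDomain R] {m : ℕ}
    (L : Submodule R (Fin m → R)) (hL : ∀ g : R, g ≠ 0 → ∀ w, g • w ∈ L → w ∈ L) :
    ∃ (n : ℕ) (U : Fin m → Fin n → R), LinearMap.ker (Fintype.linearCombination R U) = L := by
  let S := nonZeroDivisors R
  let K := Localization S
  let V := LocalizedModule S ((Fin m → R) ⧸ L)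
  let _ : Field K := inferInstanceAs (Field (FractionRing R))
  let ι : ((Fin m → R) ⧸ L) →ₗ[R] V := LocalizedModule.mkLinearMap S _
  have : Module.Finite K V := Module.Finite.of_isLocalizedModule S (Rₚ := K) ι
  let b := Module.finBasis K V
  let ψ : (Fin m → R) → Fin (Module.finrank K V) → K := fun w i => b.repr (ι (L.mkQ w)) i
  -- `d` is a common denominator for the coordinates of the classes of the unit vectors; scaling by
  -- it makes the matrix of `ψ` integral without changing the kernel.
  obtain ⟨d, hd⟩ := IsLocalization.exist_integer_multiples_of_finite S
    (fun v : Fin m × Fin (Module.finrank K V) => ψ (Pi.single v.1 1) v.2)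
  choose U hU using hd
  have key : ∀ w i, algebraMap R K (Fintype.linearCombination R (fun j i => U (j, i)) w i)
      = (d : R) • ψ w i := by
    intro w i
    have hw : ψ w i = ∑ j, w j • ψ (Pi.single j 1) i := by
      have : w = ∑ j, w j • (Pi.single j 1 : Fin m → R) := pi_eq_sum_univ' w
      conv_lhs => rw [this]
      simp only [ψ, map_sum, map_smul, Finsupp.coe_finsetSum, Finset.sum_apply]
      refine Finset.sum_congr rfl fun j _ => ?_
      rw [← algebraMap_smul K (w j) (ι _), map_smul, Finsupp.smul_apply, algebraMap_smul]
    rw [hw, Fintype.linearCombination_apply, Finset.sum_apply, map_sum, Finset.smul_sum]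
    refine Finset.sum_congr rfl fun j _ => ?_
    rw [Pi.smul_apply, smul_eq_mul, map_mul, hU, smul_comm, Algebra.smul_def (w j)]
  refine ⟨_, fun j i => U (j, i), ?_⟩
  ext w
  have h1 : Fintype.linearCombination R (fun j i => U (j, i)) w = 0 ↔ ι (L.mkQ w) = 0 := by
    rw [← b.repr.map_eq_zero_iff, Finsupp.ext_iff, funext_iff]
    refine forall_congr' fun i => ?_
    rw [Pi.zero_apply, ← map_eq_zero_iff (algebraMap R K) (IsFractionRing.injective R K), key,
      Algebra.smul_def, mul_eq_zero, or_iff_right]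
    · rfl
    · exact (map_ne_zero_iff _ (IsFractionRing.injective R K)).2 (nonZeroDivisors.ne_zero d.2)
  rw [LinearMap.mem_ker, h1, IsLocalizedModule.eq_zero_iff S ι]
  constructor
  · rintro ⟨c, hc⟩
    -- Localization kills only torsion, and saturation says that the quotient by `L` has none.
    refine hL c (nonZeroDivisors.ne_zero c.2) w ?_
    rw [← Submodule.Quotient.mk_eq_zero]
    exact hc
  · intro hw
    exact ⟨1, by rw [one_smul]; exact (Submodule.Quotient.mk_eq_zero L).2 hw⟩

end Saturated

/-! ### Symbolic powers and Laurent monomials -/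

section SymbolicPower

variable {K : Type u} [Field K] [DifferenceRing K] {n : ℕ}

theorem symPow_eq_prod_range (a : K) (p : ℤ[X]) {N : ℕ} (hN : p.natDegree < N) :
    symPow a p =
      ∏ i ∈ Finset.range N, ((⇑(DifferenceRing.σ (R := K)))^[i] a) ^ (p.coeff i) := by
  refine Finset.prod_subset (fun i hi => ?_) fun i _ hi => ?_
  · exact Finset.mem_range.2 ((le_natDegree_of_mem_supp i hi).trans_lt hN)
  · rw [notMem_support_iff.1 hi, zpow_zero]

theorem iterate_σ_ne_zero {a : K} (ha : a ≠ 0) (i : ℕ) :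
    (⇑(DifferenceRing.σ (R := K)))^[i] a ≠ 0 := by
  induction i with
  | zero => exact ha
  | succ i ih => rw [Function.iterate_succ_apply']; exact (_root_.map_ne_zero _).2 ih

theorem symPow_add {a : K} (ha : a ≠ 0) (p q : ℤ[X]) :
    symPow a (p + q) = symPow a p * symPow a q := by
  have hN := natDegree_add_le p q
  rw [symPow_eq_prod_range a (p + q) (Nat.lt_succ_of_le hN),
    symPow_eq_prod_range a p (Nat.lt_succ_of_le (le_max_left _ q.natDegree)),
    symPow_eq_prod_range a q (Nat.lt_succ_of_le (le_max_right p.natDegree _)),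
    ← Finset.prod_mul_distrib]
  exact Finset.prod_congr rfl fun i _ => by
    rw [coeff_add, zpow_add₀ (iterate_σ_ne_zero ha i)]

theorem σ_symPow (a : K) (p : ℤ[X]) :
    DifferenceRing.σ (symPow a p) = symPow a (X * p) := by
  -- The extra `+ 1` lets the factor at `i = 0` be split off; it is trivial since `X * p` has no
  -- constant term.
  have h : (X * p).natDegree < p.natDegree + 1 + 1 :=
    Nat.lt_succ_of_le (natDegree_mul_le.trans (by rw [natDegree_X, add_comm]))
  rw [symPow_eq_prod_range a p (Nat.lt_succ_self _), symPow_eq_prod_range a _ h,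
    Finset.prod_range_succ' _ (p.natDegree + 1), map_prod, coeff_X_mul_zero, zpow_zero, mul_one]
  exact Finset.prod_congr rfl fun i _ => by
    rw [coeff_X_mul, map_zpow₀, Function.iterate_succ_apply']

/-- `w ↦ t ^ w` as a monoid homomorphism. -/
noncomputable def laurentHom (t : Fin n → K) (ht : ∀ i, t i ≠ 0) :
    Multiplicative (Fin n → ℤ[X]) →* K where
  toFun w := laurentMonomial t w.toAdd
  map_one' := by simp [laurentMonomial, symPow]
  map_mul' v w := by
    simp only [laurentMonomial, toAdd_mul, Pi.add_apply, symPow_add (ht _),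
      Finset.prod_mul_distrib]

theorem iterate_σ_laurentMonomial (t : Fin n → K) (w : Fin n → ℤ[X]) (d : ℕ) :
    (⇑(DifferenceRing.σ (R := K)))^[d] (laurentMonomial t w) =
      laurentMonomial t ((X : ℤ[X]) ^ d • w) := by
  induction d with
  | zero => simp
  | succ d ih =>
    rw [Function.iterate_succ_apply', ih, pow_succ', mul_smul]
    simp only [laurentMonomial, map_prod, σ_symPow, Pi.smul_apply, smul_eq_mul]

theorem eq_sum_coeff_single (w : Fin n → ℤ[X]) :
    w = ∑ i, ∑ d ∈ (w i).support, (w i).coeff d • (Pi.single i (X ^ d) : Fin n → ℤ[X]) := by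
  conv_lhs => rw [← Finset.univ_sum_single w]
  refine Finset.sum_congr rfl fun i _ => ?_
  conv_lhs => rw [(w i).as_sum_support_C_mul_X_pow]
  rw [← AddMonoidHom.single_apply, map_sum]
  refine Finset.sum_congr rfl fun d _ => ?_
  rw [AddMonoidHom.single_apply, ← Pi.single_smul]
  simp

/-- A monoid homomorphism which on the vectors `xᵈ eᵢ` agrees with `w ↦ t ^ w` agrees with it
everywhere. -/
theorem laurentMonomial_eq_of_single (Θ : Multiplicative (Fin n → ℤ[X]) →* K) (t : Fin n → K)
    (h : ∀ i d, (⇑(DifferenceRing.σ (R := K)))^[d] (t i) =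
      Θ (Multiplicative.ofAdd (Pi.single i (X ^ d)))) (w : Fin n → ℤ[X]) :
    laurentMonomial t w = Θ (Multiplicative.ofAdd w) := by
  conv_rhs => rw [eq_sum_coeff_single w]
  simp only [laurentMonomial, symPow, h, ofAdd_sum, ofAdd_zsmul, map_prod]
  refine Finset.prod_congr rfl fun i _ => Finset.prod_congr rfl fun d _ => ?_
  -- The source is a group, so `Θ` takes unit values and respects negative powers.
  have hΘ : ∀ v, Θ v = Θ.toHomUnits v := fun _ => rfl
  rw [hΘ, hΘ, map_zpow, Units.val_zpow_eq_zpow_val]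

end SymbolicPower

/-! ### Exponents of monomials -/

section Exponents

variable {m n : ℕ}

/-- The exponent of `t` in the value of a monomial of `k{y₁, …, yₘ}` at `(t ^ u₁, …, t ^ uₘ)`. -/
noncomputable def torusExponent (U : Fin m → Fin n → ℤ[X]) :
    (Fin m × ℕ →₀ ℕ) →+ (Fin n → ℤ[X]) :=
  Finsupp.liftAddHom fun v => (multiplesHom _) ((X : ℤ[X]) ^ v.2 • U v.1)

theorem torusExponent_single (U : Fin m → Fin n → ℤ[X]) (v : Fin m × ℕ) (c : ℕ) :
    torusExponent U (Finsupp.single v c) = c • ((X : ℤ[X]) ^ v.2 • U v.1) := by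
  simp [torusExponent]

/-- The exponent of the difference monomial `Y ^ a` as a monomial in the variables `σⁱ(yⱼ)`. -/
noncomputable def monomialExponent (a : Fin m → ℕ[X]) : Fin m × ℕ →₀ ℕ :=
  ∑ j, ∑ i ∈ (a j).support, Finsupp.single (j, i) ((a j).coeff i)

theorem diffMonomial_eq_monomial (k : Type u) [Field k] (a : Fin m → ℕ[X]) :
    diffMonomial k a = MvPolynomial.monomial (monomialExponent a) 1 := by
  simp only [diffMonomial, monomialExponent, MvPolynomial.monomial_sum_one,
    MvPolynomial.X_pow_eq_monomial]

theorem monomialExponent_apply (a : Fin m → ℕ[X]) (v : Fin m × ℕ) :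
    monomialExponent a v = (a v.1).coeff v.2 := by
  obtain ⟨j, i⟩ := v
  simp only [monomialExponent, Finsupp.coe_finsetSum, Finset.sum_apply, Finsupp.single_apply,
    Prod.mk.injEq]
  rw [Finset.sum_eq_single j (fun l _ hl => by simp [hl]) (by simp)]
  simp only [true_and, Finset.sum_ite_eq', mem_support_iff]
  simp +contextual

theorem monomialExponent_surjective :
    Function.Surjective (monomialExponent (m := m)) := by
  intro s
  refine ⟨fun j => ⟨⟨s.curry j⟩⟩, Finsupp.ext fun v => ?_⟩
  rw [monomialExponent_apply]
  rfl

theorem torusExponent_monomialExponent (U : Fin m → Fin n → ℤ[X]) (a : Fin m → ℕ[X]) :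
    torusExponent U (monomialExponent a) =
      Fintype.linearCombination ℤ[X] U (toIntVec a) := by
  simp only [monomialExponent, map_sum, torusExponent_single, Fintype.linearCombination_apply,
    toIntVec]
  refine Finset.sum_congr rfl fun j _ => ?_
  conv_rhs => rw [(a j).as_sum_support_C_mul_X_pow]
  rw [Polynomial.map_sum, Finset.sum_smul]
  refine Finset.sum_congr rfl fun i _ => ?_
  simp [mul_smul, Nat.cast_smul_eq_nsmul]

end Exponents

/-! ### The generic point of the torus -/

section GenericPoint

/-- Unique sums in the exponent group exclude zero divisors in the group algebra. -/
instance uniqueSums_int_polynomial : UniqueSums ℤ[X] :=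
  UniqueSums.of_injective_addHom
    (⟨fun p i => p.coeff i, fun p q => funext fun i => coeff_add p q i⟩ :
      ℤ[X] →ₙ+ (ℕ → ℤ))
    (fun _ _ h => Polynomial.ext fun i => congrFun h i) inferInstance

variable (k : Type u) [Field k] [DifferenceRing k] (n : ℕ)

/-- The ring of Laurent difference polynomials `k{t₁^±, …, tₙ^±}`, the group algebra of
`ℤ[x]ⁿ`. -/
abbrev LaurentDiffPoly : Type u := AddMonoidAlgebra k (Fin n → ℤ[X])

instance : IsDomain (LaurentDiffPoly k n) := NoZeroDivisors.to_isDomain _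

/-- Multiplication by `x` on `ℤ[x]ⁿ`. -/
noncomputable def shiftHom : (Fin n → ℤ[X]) →+ (Fin n → ℤ[X]) :=
  DistribSMul.toAddMonoidHom _ (X : ℤ[X])

/-- The difference operator of `k{t₁^±, …, tₙ^±}`. -/
noncomputable def laurentσ : LaurentDiffPoly k n →+* LaurentDiffPoly k n :=
  (AddMonoidAlgebra.mapRingHom _ DifferenceRing.σ).comp
    (AddMonoidAlgebra.mapDomainRingHom k (shiftHom n))

theorem laurentσ_single (w : Fin n → ℤ[X]) (c : k) :
    laurentσ k n (AddMonoidAlgebra.single w c) =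
      AddMonoidAlgebra.single ((X : ℤ[X]) • w) (DifferenceRing.σ c) := by
  simp [laurentσ, shiftHom]

/-- Both multiplication by `x` on exponents and `σ` on the field `k` are injective. This is what
lets `σ` extend to the fraction field. -/
theorem laurentσ_injective : Function.Injective (laurentσ k n) := by
  have h1 : Function.Injective (shiftHom n) := smul_right_injective _ X_ne_zero
  exact (AddMonoidAlgebra.map_injective _ (DifferenceRing.σ (R := k)).injective).comp
    (AddMonoidAlgebra.mapDomain_injective h1)

/-- The fraction field `k⟨t₁, …, tₙ⟩` of the Laurent difference polynomials. -/
noncomputable def genericExtension : DifferenceExtension k where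
  carrier := FractionRing (LaurentDiffPoly k n)
  difference := ⟨IsFractionRing.map (laurentσ_injective k n)⟩
  σ_algebraMap c := by
    have h : ∀ c : k, algebraMap k (FractionRing (LaurentDiffPoly k n)) c =
        algebraMap (LaurentDiffPoly k n) _ (AddMonoidAlgebra.single 0 c) := fun c =>
      IsScalarTower.algebraMap_apply k (LaurentDiffPoly k n) _ c
    change IsFractionRing.map (laurentσ_injective k n) _ = _
    rw [h, h]
    refine (IsLocalization.map_eq _ _).trans ?_
    rw [laurentσ_single, smul_zero]

/-- The inclusion of `k{t₁^±, …, tₙ^±}` into `k⟨t₁, …, tₙ⟩`. -/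
noncomputable def toGeneric : LaurentDiffPoly k n →ₐ[k] genericExtension k n :=
  Algebra.algHom k (LaurentDiffPoly k n) (FractionRing (LaurentDiffPoly k n))

theorem toGeneric_injective : Function.Injective (toGeneric k n) :=
  IsFractionRing.injective (LaurentDiffPoly k n) (FractionRing (LaurentDiffPoly k n))

theorem σ_toGeneric (f : LaurentDiffPoly k n) :
    DifferenceRing.σ (toGeneric k n f) = toGeneric k n (laurentσ k n f) :=
  IsLocalization.map_eq (M := nonZeroDivisors (LaurentDiffPoly k n))
    (T := nonZeroDivisors (LaurentDiffPoly k n)) (S := FractionRing (LaurentDiffPoly k n))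
    (Q := FractionRing (LaurentDiffPoly k n))
    (nonZeroDivisors_le_comap_nonZeroDivisors_of_injective _ (laurentσ_injective k n)) f

/-- The generic point `(t₁, …, tₙ)` of the torus. -/
noncomputable def genericPoint (i : Fin n) : genericExtension k n :=
  toGeneric k n (AddMonoidAlgebra.single (Pi.single i 1) 1)

theorem genericPoint_ne_zero (i : Fin n) : genericPoint k n i ≠ 0 := by
  rw [genericPoint, map_ne_zero_iff _ (toGeneric_injective k n)]
  simp

theorem laurentMonomial_genericPoint (w : Fin n → ℤ[X]) :
    laurentMonomial (genericPoint k n) w = toGeneric k n (AddMonoidAlgebra.single w 1) := by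
  refine laurentMonomial_eq_of_single
    ((toGeneric k n : LaurentDiffPoly k n →* genericExtension k n).comp (AddMonoidAlgebra.of k (Fin n → ℤ[X]))) _ (fun i d => ?_) w
  change _ = toGeneric k n (AddMonoidAlgebra.single (Pi.single i (X ^ d)) 1)
  induction d with
  | zero => simp [genericPoint]
  | succ d ih =>
    rw [Function.iterate_succ_apply', ih, σ_toGeneric, laurentσ_single, map_one, pow_succ',
      ← Pi.single_smul, smul_eq_mul]

end GenericPoint

/-! ### Vanishing ideals of tori and Cohn closures -/

section VanishingIdeal

variable {k : Type u} [Field k] [DifferenceRing k] {m n : ℕ}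

theorem evalAt_diffPolyσ (K : DifferenceExtension k) (a : Fin m → K) (f : DiffPoly k m) :
    evalAt K a (diffPolyσ f) = DifferenceRing.σ (evalAt K a f) := by
  have h : (evalAt K a).comp diffPolyσ = (DifferenceRing.σ (R := K)).comp (evalAt K a) := by
    apply MvPolynomial.ringHom_ext
    · intro c
      simp [evalAt, diffPolyσ, K.σ_algebraMap]
    · intro v
      simp [evalAt, diffPolyσ, Function.iterate_succ_apply', -Function.iterate_succ]
  exact congrArg (fun φ : DiffPoly k m →+* K => φ f) h

theorem isDifferenceIdeal_vanishingIdeal (X : AffineSubset k m) :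
    IsDifferenceIdeal (vanishingIdeal X) := fun f hf K a ha => by
  rw [evalAt_diffPolyσ, hf K a ha, map_zero]

theorem evalAt_laurentMonomial (U : Fin m → Fin n → ℤ[X]) (K : DifferenceExtension k)
    (t : Fin n → K) (ht : ∀ i, t i ≠ 0) (f : DiffPoly k m) :
    evalAt K (fun j => laurentMonomial t (U j)) f =
      AddMonoidAlgebra.lift k K (Fin n → ℤ[X]) (laurentHom t ht)
        (AddMonoidAlgebra.mapDomainRingHom k (torusExponent U) f) := by
  have h : evalAt K (fun j => laurentMonomial t (U j)) =
      (AddMonoidAlgebra.lift k K (Fin n → ℤ[X]) (laurentHom t ht) : _ →+* K).comp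
        (AddMonoidAlgebra.mapDomainRingHom k (torusExponent U)) := by
    apply MvPolynomial.ringHom_ext
    · intro c
      have hC : (MvPolynomial.C c : DiffPoly k m) = AddMonoidAlgebra.single 0 c := rfl
      rw [evalAt, MvPolynomial.coe_eval₂Hom, MvPolynomial.eval₂_C, RingHom.comp_apply, hC]
      simp [Algebra.smul_def]
    · intro v
      have hX : (MvPolynomial.X v : DiffPoly k m) =
        AddMonoidAlgebra.single (Finsupp.single v 1) 1 := rfl
      rw [evalAt, MvPolynomial.coe_eval₂Hom, MvPolynomial.eval₂_X, RingHom.comp_apply, hX,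
        iterate_σ_laurentMonomial]
      simp only [AddMonoidAlgebra.mapDomainRingHom_apply, AddMonoidAlgebra.mapDomain_single,
        torusExponent_single, one_smul, RingHom.coe_coe, AddMonoidAlgebra.lift_single]
      rfl
  exact congrArg (fun φ : DiffPoly k m →+* K => φ f) h

/-- The vanishing ideal of a quasi difference torus is the kernel of `Y ↦ t ^ U`. -/
theorem mem_vanishingIdeal_quasiTorus (U : Fin m → Fin n → ℤ[X]) (f : DiffPoly k m) :
    f ∈ vanishingIdeal (quasiTorus k U) ↔
      AddMonoidAlgebra.mapDomain (torusExponent U) f = 0 := by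
  constructor
  · intro hf
    -- One test point suffices: at the generic point the evaluation of Laurent polynomials is the
    -- injective map `toGeneric`.
    have h := hf (genericExtension k n) _ ⟨_, genericPoint_ne_zero k n, rfl⟩
    rw [evalAt_laurentMonomial U _ _ (genericPoint_ne_zero k n)] at h
    have hl : AddMonoidAlgebra.lift k (genericExtension k n) (Fin n → ℤ[X])
        (laurentHom _ (genericPoint_ne_zero k n)) = toGeneric k n := by
      refine AddMonoidAlgebra.algHom_ext (fun w => ?_) (Subsingleton.elim _ _)
      rw [AddMonoidAlgebra.lift_single, one_smul]
      exact laurentMonomial_genericPoint k n w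
    rw [hl] at h
    exact (map_eq_zero_iff _ (toGeneric_injective k n)).1 h
  · rintro hf K _ ⟨t, ht, rfl⟩
    rw [evalAt_laurentMonomial U K t ht, AddMonoidAlgebra.mapDomainRingHom_apply, hf, map_zero]

/-- Every monomial in the `σⁱ(yⱼ)` is some `Y ^ a`, so this is a scalar multiple of a generator. -/
theorem monomial_sub_monomial_mem_latticeIdeal (U : Fin m → Fin n → ℤ[X])
    {s s' : Fin m × ℕ →₀ ℕ} (h : torusExponent U s = torusExponent U s') (c : k) :
    (MvPolynomial.monomial s c - MvPolynomial.monomial s' c : DiffPoly k m) ∈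
      latticeIdeal k (LinearMap.ker (Fintype.linearCombination ℤ[X] U)) := by
  obtain ⟨a, rfl⟩ := monomialExponent_surjective s
  obtain ⟨b, rfl⟩ := monomialExponent_surjective s'
  have hc : ∀ s : Fin m × ℕ →₀ ℕ, (MvPolynomial.monomial s c : DiffPoly k m) =
      MvPolynomial.C c * MvPolynomial.monomial s 1 := fun s => by
    rw [MvPolynomial.C_mul_monomial, mul_one]
  rw [hc, hc (monomialExponent b), ← mul_sub]
  refine Ideal.mul_mem_left _ _ (Submodule.mem_sInf.2 fun I hI => hI.2 ⟨a, b, ?_, ?_⟩)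
  · rw [LinearMap.mem_ker, map_sub, ← torusExponent_monomialExponent,
      ← torusExponent_monomialExponent, h, sub_self]
  · rw [diffMonomial_eq_monomial, diffMonomial_eq_monomial]

theorem vanishingIdeal_quasiTorus (U : Fin m → Fin n → ℤ[X]) :
    vanishingIdeal (quasiTorus k U) =
      latticeIdeal k (LinearMap.ker (Fintype.linearCombination ℤ[X] U)) := by
  apply le_antisymm
  · intro f hf
    rw [mem_vanishingIdeal_quasiTorus] at hf
    -- `r` picks one representative in each fibre of `torusExponent U`. Modulo the lattice ideal `f`
    -- equals its image under `r`, which vanishes because it factors through the image of `f` in the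
    -- group algebra.
    let r : (Fin m × ℕ →₀ ℕ) → (Fin m × ℕ →₀ ℕ) :=
      Function.invFun (torusExponent U) ∘ torusExponent U
    have hr : ∀ s, torusExponent U s = torusExponent U (r s) := fun s =>
      (Function.invFun_eq ⟨s, rfl⟩).symm
    have hsub : ∀ f : DiffPoly k m, f - AddMonoidAlgebra.mapDomain r f ∈
        latticeIdeal k (LinearMap.ker (Fintype.linearCombination ℤ[X] U)) := by
      intro f
      induction f using MvPolynomial.induction_on' with
      | monomial s c =>
        rw [← MvPolynomial.single_eq_monomial, AddMonoidAlgebra.mapDomain_single]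
        exact monomial_sub_monomial_mem_latticeIdeal U (hr s) c
      | add p q hp hq =>
        rw [AddMonoidAlgebra.mapDomain_add, add_sub_add_comm]
        exact add_mem hp hq
    have hrf : AddMonoidAlgebra.mapDomain r f = 0 := by
      have h : AddMonoidAlgebra.mapDomain r f = AddMonoidAlgebra.mapDomain
          (Function.invFun (torusExponent U)) (AddMonoidAlgebra.mapDomain (torusExponent U) f) :=
        congrArg AddMonoidAlgebra.ofCoeff Finsupp.mapDomain_comp
      rw [h, hf, AddMonoidAlgebra.mapDomain_zero]
    simpa [hrf] using hsub f
  · refine sInf_le ⟨isDifferenceIdeal_vanishingIdeal _, ?_⟩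
    rintro _ ⟨a, b, hab, rfl⟩
    rw [SetLike.mem_coe, mem_vanishingIdeal_quasiTorus,
      ← AddMonoidAlgebra.mapDomainRingHom_apply, map_sub, sub_eq_zero, diffMonomial_eq_monomial,
      diffMonomial_eq_monomial, ← MvPolynomial.single_eq_monomial,
      ← MvPolynomial.single_eq_monomial, AddMonoidAlgebra.mapDomainRingHom_apply,
      AddMonoidAlgebra.mapDomainRingHom_apply, AddMonoidAlgebra.mapDomain_single,
      AddMonoidAlgebra.mapDomain_single, torusExponent_monomialExponent,
      torusExponent_monomialExponent]
    rw [LinearMap.mem_ker, map_sub, sub_eq_zero] at hab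
    rw [hab]

theorem le_zeroLocus_vanishingIdeal (T : AffineSubset k m) :
    T ≤ zeroLocus (vanishingIdeal T : Set (DiffPoly k m)) :=
  fun K a ha _ hf => hf K a ha

theorem zeroLocus_vanishingIdeal_le {T Y : AffineSubset k m} (hY : IsDifferenceVariety Y)
    (hT : T ≤ Y) : zeroLocus (vanishingIdeal T : Set (DiffPoly k m)) ≤ Y := by
  obtain ⟨F, rfl⟩ := hY
  exact fun K a ha f hf => ha f fun K' b hb => hT K' hb f hf

theorem isCohnClosure_iff {T X : AffineSubset k m} :
    IsCohnClosure T X ↔ X = zeroLocus (vanishingIdeal T : Set (DiffPoly k m)) := by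
  have h : IsCohnClosure T (zeroLocus (vanishingIdeal T : Set (DiffPoly k m))) :=
    ⟨⟨⟨_, rfl⟩, le_zeroLocus_vanishingIdeal T⟩, fun _ hY =>
      zeroLocus_vanishingIdeal_le hY.1 hY.2⟩
  exact ⟨fun hX => hX.unique h, fun hX => hX ▸ h⟩

theorem vanishingIdeal_zeroLocus_vanishingIdeal (T : AffineSubset k m) :
    vanishingIdeal (zeroLocus (vanishingIdeal T : Set (DiffPoly k m))) = vanishingIdeal T :=
  le_antisymm (fun _ hf K a ha => hf K a (le_zeroLocus_vanishingIdeal T K ha))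
    fun f hf _ _ ha => ha f hf

/-- The target `ℤ[x]ⁿ` is torsion-free. -/
theorem isToricLattice_ker (U : Fin m → Fin n → ℤ[X]) :
    IsToricLattice (LinearMap.ker (Fintype.linearCombination ℤ[X] U)) := by
  intro g hg w hw
  rw [LinearMap.mem_ker, map_smul] at hw
  exact (smul_eq_zero.1 hw).resolve_left hg

end VanishingIdeal

end ToricDifference

theorem mainTheorem1 {k : Type u} [Field k] [CharZero k] [ToricDifference.DifferenceRing k]
    (m : ℕ) (X : ToricDifference.AffineSubset k m)
    (hX : ToricDifference.IsDifferenceVariety X) :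
    ToricDifference.IsToric X ↔
      ToricDifference.IsToricIdeal (ToricDifference.vanishingIdeal X) := by
  open ToricDifference in
  constructor
  · rintro ⟨n, U, h⟩
    rw [isCohnClosure_iff] at h
    refine ⟨_, isToricLattice_ker U, ?_⟩
    rw [h, vanishingIdeal_zeroLocus_vanishingIdeal, vanishingIdeal_quasiTorus]
  · rintro ⟨L, hL, h⟩
    obtain ⟨n, U, rfl⟩ := exists_ker_linearCombination_eq L hL
    refine ⟨n, U, isCohnClosure_iff.2 ?_⟩
    rw [vanishingIdeal_quasiTorus, ← h]
    -- A difference variety is recovered from its own vanishing ideal.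
    exact le_antisymm (le_zeroLocus_vanishingIdeal X) (zeroLocus_vanishingIdeal_le hX le_rfl)
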